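/- Let $\Gamma$ be a finite simplicial graph (no loops, no multiple edges) with vertex set $V(\Gamma)$ and edge set $E(\Gamma)$, and let \[ A(\Gamma)=\langle V(\Gamma)\mid [v,w]\ \text{for } (v,w)\in E(\Gamma)\rangle \] be the right-angled Artin group on $\Gamma$. For a group $G$ with commutator subgroup $G'$ and $g\in G'$, let $\mathrm{cl}(g)$ be the least $k\ge 0$ such that $g$ is a product of $k$ commutators of elements of $G$, and let $\mathrm{scl}(g)=\lim_{n\to\infty}\mathrm{cl}(g^n)/n$ be the stable commutator length of $g$ in $G$ (the limit exists since $\mathrm{cl}$ is subadditive). 1. Every non-trivial element $g_0$ of the commutator subgroup $A(\Gamma)'$ satisfies $\mathrm{scl}(g_0)\ge 1/2$. 2. Every commutator $[a,b]$ with $a,b\in A(\Gamma)$ satisfies $\mathrm{scl}([a,b])\le 1/2$. 3. The bound in 1 is sharp: if $\Gamma$ has two distinct non-adjacent vertices (equivalently, if $A(\Gamma)$ is not abelian), then there is a non-trivial commutator $c\in A(\Gamma)'$ with $\mathrm{scl}(c)=1/2$. -/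

import Mathlib

open Filter Topology
open scoped commutatorElement

/-- The defining relators `[v, w]`, one for each edge `(v, w)` of `Γ`, in the free group on the
vertices. -/
def raagRelators {V : Type*} (Γ : SimpleGraph V) : Set (FreeGroup V) :=
  {r | ∃ v w : V, Γ.Adj v w ∧ r = ⁅FreeGroup.of v, FreeGroup.of w⁆}

/-- The right-angled Artin group `A(Γ) = ⟨V(Γ) ∣ [v, w], (v, w) ∈ E(Γ)⟩`. -/
abbrev RAAG {V : Type*} (Γ : SimpleGraph V) : Type _ :=
  PresentedGroup (raagRelators Γ)

/-- `g` is a product of `k` commutators `[a₁, b₁] ⋯ [aₖ, bₖ]` of elements of `G`. -/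
def IsProdOfCommutators {G : Type*} [Group G] (g : G) (k : ℕ) : Prop :=
  ∃ l : List (G × G), l.length = k ∧ (l.map fun p => ⁅p.1, p.2⁆).prod = g

/-- The commutator length `cl(g)` of an element `g` of the commutator subgroup `G'`: the least
number of commutators whose product is `g`. The set is non-empty, see
`exists_isProdOfCommutators`. -/
noncomputable def commutatorLength {G : Type*} [Group G] (g : commutator G) : ℕ :=
  sInf {k : ℕ | IsProdOfCommutators (g : G) k}

/-- The stable commutator length `scl(g) = lim cl(g ^ n) / n` of an element `g` of the commutator
subgroup `G'`. The limit exists, see `tendsto_scl`. -/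
noncomputable def scl {G : Type*} [Group G] (g : commutator G) : ℝ :=
  limUnder atTop fun n : ℕ => (commutatorLength (g ^ n) : ℝ) / n

theorem IsProdOfCommutators.mul {G : Type*} [Group G] {g h : G} {k m : ℕ}
    (hg : IsProdOfCommutators g k) (hh : IsProdOfCommutators h m) :
    IsProdOfCommutators (g * h) (k + m) := by
  obtain ⟨l, rfl, rfl⟩ := hg
  obtain ⟨l', rfl, rfl⟩ := hh
  exact ⟨l ++ l', by simp, by simp⟩

theorem exists_isProdOfCommutators {G : Type*} [Group G] (g : commutator G) :
    ∃ k, IsProdOfCommutators (g : G) k := by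
  have hg : (g : G) ∈ Subgroup.closure (commutatorSet G) := commutator_eq_closure G ▸ g.2
  generalize (g : G) = x at hg
  induction hg using Subgroup.closure_induction'' with
  | mem x hx =>
    obtain ⟨a, b, rfl⟩ := hx
    exact ⟨1, [(a, b)], by simp, by simp⟩
  | inv_mem x hx =>
    obtain ⟨a, b, rfl⟩ := hx
    exact ⟨1, [(b, a)], by simp, by simp⟩
  | one => exact ⟨0, [], by simp, by simp⟩
  | mul x y _ _ ihx ihy =>
    obtain ⟨k, hk⟩ := ihx
    obtain ⟨m, hm⟩ := ihy
    exact ⟨k + m, hk.mul hm⟩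

theorem isProdOfCommutators_commutatorLength {G : Type*} [Group G] (g : commutator G) :
    IsProdOfCommutators (g : G) (commutatorLength g) :=
  Nat.sInf_mem (exists_isProdOfCommutators g)

theorem commutatorLength_mul_le {G : Type*} [Group G] (g h : commutator G) :
    commutatorLength (g * h) ≤ commutatorLength g + commutatorLength h :=
  Nat.sInf_le
    ((isProdOfCommutators_commutatorLength g).mul (isProdOfCommutators_commutatorLength h))

/-- The limit defining `scl` exists. -/
theorem tendsto_scl {G : Type*} [Group G] (g : commutator G) :
    Tendsto (fun n : ℕ => (commutatorLength (g ^ n) : ℝ) / n) atTop (𝓝 (scl g)) := by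
  have hsub : Subadditive fun n : ℕ => (commutatorLength (g ^ n) : ℝ) := fun m n => by
    show (commutatorLength (g ^ (m + n)) : ℝ) ≤ commutatorLength (g ^ m) + commutatorLength (g ^ n)
    rw [pow_add]
    exact_mod_cast commutatorLength_mul_le (g ^ m) (g ^ n)
  refine tendsto_nhds_limUnder ⟨hsub.lim, hsub.tendsto_lim ⟨0, ?_⟩⟩
  rintro _ ⟨n, rfl⟩
  positivity

/-! The lower bound comes from integer functions `φ` of defect one, i.e. `φ g + φ h ≤ φ (g * h) ≤ φ
g + φ h + 1`. Such a `φ` is at least `-2` on commutators, hence at least `-(2k+1)` on a product of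
`k` of them. If also `φ (g ^ N) ≤ -N` for all `N`, then `N ≤ 2 cl(g ^ N) + 1` and `scl g ≥ 1/2`. So
each `g ≠ 1` needs such a `φ` (`RAAG.exists_isDefectOne`).

On a free group, `φ` is a coarse translation number. A periodic reduced word determines a
left-invariant linear order on `FreeGroup X × ℤ`, invariant under a shift of the fibres by the
period `n`. Then `φ g` locates the point `(g, 0)` among the points `(1, n * m)`. The order is
assembled from local orders at the vertices of the Cayley tree, chosen so that powers of the word
drift downwards. It only uses a linear order on `X`, so `φ` is invariant under order automorphisms
of `X` (`FreeGroup.exists_isDefectOne`) and extends to semidirect products.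

For a right-angled Artin group, retract `g` to a minimal vertex set `S` on which it survives and
remove some `v ∈ S`. The image of `g` lies in the kernel of the retraction to `S \ {v}`. This kernel
is free on the cosets of the link of `v`, and the complement acts on them preserving a linear order,
because parabolic subgroups are relatively convex (`relConvex_parabolic`).

The upper bound is the identity `[a,b]^(2m) = c [a, b^(2m)]` with `c` a product of `m` commutators
(`mul_pow_two_mul`). -/

/-! ### Chains and cut systems: gluing local linear orders along a tree. -/

theorem Int.exists_forall_iff_le {P : ℤ → Prop} (hP : ∀ i j, i ≤ j → P j → P i)
    (h₁ : ∃ i, P i) (h₂ : ∃ i, ¬ P i) : ∃ k, ∀ i, P i ↔ i ≤ k := by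
  obtain ⟨b, hb⟩ := h₂
  obtain ⟨k, hk, hk'⟩ := Int.exists_greatest_of_bdd (P := P)
    ⟨b, fun z hz => le_of_not_ge fun h => hb (hP _ _ h hz)⟩ h₁
  exact ⟨k, fun i => ⟨hk' i, fun h => hP _ _ h hk⟩⟩

/-- A two-sided, strictly increasing, unbounded sequence. -/
structure IsIntChain {B : Type*} [LinearOrder B] (f : ℤ → B) : Prop where
  strictMono : StrictMono f
  exists_lt : ∀ u, ∃ i, f i < u
  exists_gt : ∀ u, ∃ i, u < f i

namespace IsIntChain

variable {B : Type*} [LinearOrder B] {f : ℤ → B}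

theorem exists_lt_iff_le (hf : IsIntChain f) (u : B) : ∃ k, ∀ i, f i < u ↔ i ≤ k := by
  refine Int.exists_forall_iff_le (fun i j hij h => (hf.strictMono.monotone hij).trans_lt h)
    (hf.exists_lt u) ?_
  obtain ⟨i, hi⟩ := hf.exists_gt u
  exact ⟨i, hi.not_gt⟩

theorem exists_le_iff_le (hf : IsIntChain f) (u : B) : ∃ k, ∀ i, f i ≤ u ↔ i ≤ k := by
  refine Int.exists_forall_iff_le (fun i j hij h => (hf.strictMono.monotone hij).trans h)
    ((hf.exists_lt u).imp fun _ => le_of_lt) ?_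
  obtain ⟨i, hi⟩ := hf.exists_gt u
  exact ⟨i, hi.not_ge⟩

/-- The largest index of a term below `u`. -/
noncomputable def lower (hf : IsIntChain f) (u : B) : ℤ := (hf.exists_lt_iff_le u).choose

theorem lt_iff_le_lower (hf : IsIntChain f) {u : B} {i : ℤ} : f i < u ↔ i ≤ hf.lower u :=
  (hf.exists_lt_iff_le u).choose_spec i

/-- The largest index of a term that is at most `u`. -/
noncomputable def floor (hf : IsIntChain f) (u : B) : ℤ := (hf.exists_le_iff_le u).choose

theorem le_iff_le_floor (hf : IsIntChain f) {u : B} {i : ℤ} : f i ≤ u ↔ i ≤ hf.floor u :=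
  (hf.exists_le_iff_le u).choose_spec i

theorem lt_iff_floor_lt (hf : IsIntChain f) {u : B} {i : ℤ} : u < f i ↔ hf.floor u < i := by
  rw [← not_le, hf.le_iff_le_floor, not_le]

end IsIntChain

/-- The inverse of a letter of a free group. -/
def invLetter {X : Type*} (l : X × Bool) : X × Bool := (l.1, !l.2)

@[simp] theorem invLetter_invLetter {X : Type*} (l : X × Bool) : invLetter (invLetter l) = l := by
  simp [invLetter]

theorem FreeGroup.invRev_cons_append {X : Type*} (l : X × Bool) (a b : List (X × Bool)) :
    FreeGroup.invRev (l :: a) ++ b = FreeGroup.invRev a ++ invLetter l :: b := by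
  simp [FreeGroup.invRev, invLetter]

theorem FreeGroup.IsReduced.ne_invLetter {X : Type*} {l m : X × Bool} {a : List (X × Bool)}
    (h : FreeGroup.IsReduced (l :: m :: a)) : m ≠ invLetter l := by
  rintro rfl
  have := (List.isChain_cons_cons.1 h).1
  simp [invLetter] at this

/-- A linear order with a chain of marked points `q` and with one chain for each letter of the free
group on `X`. It models the way in which a linear order on `FreeGroup X × ℤ` is seen from a vertex
of the Cayley tree of `FreeGroup X`: the points of the fibre over that vertex form the chain `q`,
the points in the direction of the letter `l` are grouped in the blocks `e l i`. -/
structure CutSystem (X B : Type*) [LinearOrder B] where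
  q : ℤ → B
  e : X × Bool → ℤ → B
  q_chain : IsIntChain q
  e_chain : ∀ l, IsIntChain (e l)
  e_ne_q : ∀ l i j, e l i ≠ q j
  e_inj : ∀ l m i j, e l i = e m j → l = m

namespace CutSystem

variable {X B : Type*} [LinearOrder B] (S : CutSystem X B)

/-- The block, seen from the origin of an edge labelled `l`, of a point that is seen from its
terminus as `u`. -/
noncomputable def transfer (l : X × Bool) (u : B) : ℤ :=
  if l.2 then (S.e_chain (l.1, false)).floor u + 1 else (S.e_chain (l.1, true)).lower u

theorem transfer_true_le_iff {x : X} {u : B} {i : ℤ} :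
    S.transfer (x, true) u ≤ i ↔ u < S.e (x, false) i := by
  rw [(S.e_chain (x, false)).lt_iff_floor_lt]
  simp only [transfer, if_true]
  omega

theorem le_transfer_false_iff {x : X} {u : B} {i : ℤ} :
    i ≤ S.transfer (x, false) u ↔ S.e (x, true) i < u := by
  rw [(S.e_chain (x, true)).lt_iff_le_lower]
  simp [transfer]

/-- Both sides say that some `i` separates the points: `transfer` rounds up for positive letters and
down for negative ones, so the blocks seen from the two ends of an edge interlace. Hence both ends
of the edge agree on comparisons across it. -/
theorem e_transfer_true_lt_iff {x : X} {u w : B} :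
    S.e (x, true) (S.transfer (x, true) u) < w ↔ u < S.e (x, false) (S.transfer (x, false) w) := by
  rw [← transfer_true_le_iff, ← le_transfer_false_iff]

theorem e_transfer_lt_iff {l : X × Bool} {u w : B} (hu : ∀ i, u ≠ S.e (invLetter l) i)
    (hw : ∀ i, w ≠ S.e l i) :
    S.e l (S.transfer l u) < w ↔ u < S.e (invLetter l) (S.transfer (invLetter l) w) := by
  obtain ⟨x, _ | _⟩ := l
  -- For a negative letter the positive case is negated; the non-equalities turn the resulting `≤`
  -- into `<`.
  · have h := not_congr (S.e_transfer_true_lt_iff (x := x) (u := w) (w := u))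
    rw [not_lt, not_lt] at h
    rw [(hw _).symm.le_iff_lt] at h
    exact h.symm.trans (hu _).le_iff_lt
  · exact S.e_transfer_true_lt_iff

theorem lt_e_transfer_iff {l : X × Bool} {u w : B} (hu : ∀ i, u ≠ S.e (invLetter l) i)
    (hw : ∀ i, w ≠ S.e l i) :
    w < S.e l (S.transfer l u) ↔ S.e (invLetter l) (S.transfer (invLetter l) w) < u := by
  rw [S.e_transfer_lt_iff (l := invLetter l) (by simpa using hw) hu, invLetter_invLetter]

theorem e_transfer_le {l : X × Bool} {u : B} {i : ℤ} (h : u < S.e (invLetter l) i) :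
    S.e l (S.transfer l u) ≤ S.e l i := by
  refine (S.e_chain l).strictMono.monotone ?_
  obtain ⟨x, _ | _⟩ := l
  · by_contra! h'
    have := (S.le_transfer_false_iff).1 h'.le
    exact lt_asymm this h
  · exact S.transfer_true_le_iff.2 h

/-- The position, seen from `1`, of the point `j` of the fibre over the vertex `L`. -/
noncomputable def pos (L : List (X × Bool)) (j : ℤ) : B :=
  L.foldr (fun l u => S.e l (S.transfer l u)) (S.q j)

@[simp] theorem pos_nil (j : ℤ) : S.pos [] j = S.q j := rfl

@[simp] theorem pos_cons (l : X × Bool) (L : List (X × Bool)) (j : ℤ) :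
    S.pos (l :: L) j = S.e l (S.transfer l (S.pos L j)) := rfl

theorem pos_ne_of_isReduced {l : X × Bool} {L : List (X × Bool)}
    (h : FreeGroup.IsReduced (l :: L)) (i j : ℤ) : S.pos L j ≠ S.e (invLetter l) i := by
  cases L with
  | nil => exact (S.e_ne_q _ _ _).symm
  | cons m L => exact fun hm => h.ne_invLetter (S.e_inj _ _ _ _ hm)

/-- Independence of the viewpoint: moving the observer along `a` one edge at a time preserves
comparisons, each move being `e_transfer_lt_iff`. Reducedness ensures that each edge crossed really
separates the two points. -/
theorem pos_compare {a b : List (X × Bool)} (ha : FreeGroup.IsReduced a)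
    (h : FreeGroup.IsReduced (FreeGroup.invRev a ++ b)) (i j : ℤ) :
    (S.pos a i < S.pos b j ↔ S.q i < S.pos (FreeGroup.invRev a ++ b) j) ∧
    (S.pos b j < S.pos a i ↔ S.pos (FreeGroup.invRev a ++ b) j < S.q i) := by
  induction a generalizing b with
  | nil => simp
  | cons l a ih =>
    rw [FreeGroup.invRev_cons_append] at h ⊢
    have hb : FreeGroup.IsReduced (invLetter l :: b) := (List.isChain_append.1 h).2.1
    have hu := fun k => S.pos_ne_of_isReduced ha k i
    have hw := fun k => S.pos_ne_of_isReduced hb k j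
    simp only [invLetter_invLetter] at hw
    obtain ⟨h₁, h₂⟩ := ih (List.IsChain.tail ha) h
    rw [← h₁, ← h₂]
    exact ⟨S.e_transfer_lt_iff hu hw, S.lt_e_transfer_iff hu hw⟩

theorem pos_map {Y C : Type*} [LinearOrder C] (T : CutSystem Y C) (σ : X → Y) (s : B → C)
    (hs : StrictMono s) (n : ℤ) (hq : ∀ i, s (S.q i) = T.q (i + n))
    (he : ∀ x b i, s (S.e (x, b) i) = T.e (σ x, b) (i + n)) (L : List (X × Bool)) (j : ℤ) :
    T.pos (L.map fun l => (σ l.1, l.2)) (j + n) = s (S.pos L j) := by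
  induction L with
  | nil => simp [hq]
  | cons l L ih =>
    obtain ⟨x, b⟩ := l
    simp only [List.map_cons, pos_cons, ih, he]
    congr 1
    cases b
    · refine eq_of_forall_le_iff fun i => ?_
      rw [le_transfer_false_iff, ← sub_le_iff_le_add, le_transfer_false_iff, ← hs.lt_iff_lt, he,
        sub_add_cancel]
    · refine eq_of_forall_ge_iff fun i => ?_
      rw [transfer_true_le_iff, ← le_sub_iff_add_le, transfer_true_le_iff, ← hs.lt_iff_lt, he,
        sub_add_cancel]

end CutSystem

/-! ### Comparing fibres from the median of three vertices. -/

theorem FreeGroup.IsReduced.invRev {X : Type*} {a : List (X × Bool)} (h : FreeGroup.IsReduced a) :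
    FreeGroup.IsReduced (FreeGroup.invRev a) := by
  classical
  rw [FreeGroup.isReduced_iff_reduce_eq] at h ⊢
  rw [FreeGroup.reduce_invRev, h]

/-- The longest common prefix of two reduced words. -/
theorem FreeGroup.exists_common_prefix {X : Type*} (a b : List (X × Bool))
    (ha : FreeGroup.IsReduced a) (hb : FreeGroup.IsReduced b) :
    ∃ a' b' c, a = c ++ a' ∧ b = c ++ b' ∧ FreeGroup.IsReduced (FreeGroup.invRev a' ++ b') := by
  induction a generalizing b with
  | nil => exact ⟨[], b, [], rfl, rfl, by simpa using hb⟩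
  | cons l a ih =>
    cases b with
    | nil => exact ⟨l :: a, [], [], rfl, rfl, by simpa using ha.invRev⟩
    | cons m b =>
      by_cases hlm : l = m
      · subst hlm
        obtain ⟨a', b', c, rfl, rfl, h⟩ := ih b (List.IsChain.tail ha) (List.IsChain.tail hb)
        exact ⟨a', b', l :: c, rfl, rfl, h⟩
      · refine ⟨l :: a, m :: b, [], rfl, rfl, ?_⟩
        refine List.isChain_append.2 ⟨ha.invRev, hb, fun x hx y hy => ?_⟩
        simp only [FreeGroup.invRev, List.map_cons, List.reverse_cons, List.getLast?_append,
          List.getLast?_singleton, Option.some_or, Option.mem_def, Option.some.injEq,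
          List.head?_cons] at hx hy
        subst hx hy
        intro h
        obtain ⟨x, c⟩ := l
        obtain ⟨y, d⟩ := m
        simp only at h
        subst h
        cases c <;> cases d <;> simp_all

namespace CutSystem

variable {X B : Type*} [DecidableEq X] [LinearOrder B] (S : CutSystem X B)

/-- The position, seen from `1`, of the point `j` of the fibre over the vertex `g`. -/
noncomputable def gpos (g : FreeGroup X) (j : ℤ) : B := S.pos g.toWord j

/-- Here `u`, `v`, `w` are the fibres over `1`, `g`, `g * h` seen from the median of these vertices
in the tree, found by cancelling the common part `c` of `g⁻¹` and `h`. Transitivity of the glued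
order thereby reduces to transitivity in `B`. -/
theorem exists_center (g h : FreeGroup X) : ∃ u : ℤ → B, ∃ v : ℤ → B, ∃ w : ℤ → B,
    (∀ i j, (u i < v j ↔ S.q i < S.gpos g j) ∧ (v j < u i ↔ S.gpos g j < S.q i)) ∧
    (∀ i j, (v i < w j ↔ S.q i < S.gpos h j) ∧ (w j < v i ↔ S.gpos h j < S.q i)) ∧
    (∀ i j, (u i < w j ↔ S.q i < S.gpos (g * h) j) ∧
      (w j < u i ↔ S.gpos (g * h) j < S.q i)) := by
  have hg : FreeGroup.IsReduced g.toWord := FreeGroup.isReduced_toWord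
  have hh : FreeGroup.IsReduced h.toWord := FreeGroup.isReduced_toWord
  obtain ⟨a, b, c, ha, hb, hab⟩ := FreeGroup.exists_common_prefix _ _ hg.invRev hh
  have ha' : g.toWord = FreeGroup.invRev a ++ FreeGroup.invRev c := by
    rw [← FreeGroup.invRev_append, ← ha, FreeGroup.invRev_invRev]
  have hgh : (g * h).toWord = FreeGroup.invRev a ++ b := by
    have h1 : g * h = FreeGroup.mk (FreeGroup.invRev a ++ b) := by
      conv_lhs => rw [← FreeGroup.mk_toWord (x := g), ← FreeGroup.mk_toWord (x := h), ha', hb]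
      rw [← FreeGroup.mul_mk, ← FreeGroup.mul_mk, ← FreeGroup.mul_mk, ← FreeGroup.inv_mk,
        ← FreeGroup.inv_mk]
      group
    rw [h1, FreeGroup.toWord_mk, hab.reduce_eq]
  have hra : FreeGroup.IsReduced a := by
    have := (List.isChain_append.1 (ha ▸ hg.invRev)).2.1
    exact this
  have hrc : FreeGroup.IsReduced c := (List.isChain_append.1 (hb ▸ hh)).1
  refine ⟨S.pos a, S.pos (FreeGroup.invRev c), S.pos b, fun i j => ?_, fun i j => ?_,
    fun i j => ?_⟩
  · rw [gpos, ha']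
    exact S.pos_compare hra (ha' ▸ hg) i j
  · have := S.pos_compare (a := FreeGroup.invRev c) (b := b) hrc.invRev
      (by rw [FreeGroup.invRev_invRev, ← hb]; exact hh) i j
    rwa [FreeGroup.invRev_invRev, ← hb] at this
  · rw [gpos, hgh]
    exact S.pos_compare hra hab i j

theorem q_le_gpos_mul {g h : FreeGroup X} {i j k : ℤ} (h₁ : S.q i ≤ S.gpos g j)
    (h₂ : S.q j ≤ S.gpos h k) : S.q i ≤ S.gpos (g * h) k := by
  obtain ⟨u, v, w, H₁, H₂, H₃⟩ := S.exists_center g h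
  rw [← not_lt, ← (H₁ i j).2, not_lt] at h₁
  rw [← not_lt, ← (H₂ j k).2, not_lt] at h₂
  rw [← not_lt, ← (H₃ i k).2, not_lt]
  exact h₁.trans h₂

theorem gpos_mul_lt_q {g h : FreeGroup X} {i j k : ℤ} (h₁ : S.gpos g j < S.q i)
    (h₂ : S.gpos h k < S.q j) : S.gpos (g * h) k < S.q i := by
  obtain ⟨u, v, w, H₁, H₂, H₃⟩ := S.exists_center g h
  rw [← (H₁ i j).2] at h₁
  rw [← (H₂ j k).2] at h₂
  rw [← (H₃ i k).2]
  exact h₂.trans h₁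

theorem gpos_inv_lt_q_iff {g : FreeGroup X} {i j : ℤ} :
    S.gpos g⁻¹ i < S.q j ↔ S.q i < S.gpos g j := by
  have := (S.pos_compare (a := g.toWord) (b := []) FreeGroup.isReduced_toWord
    (by simpa using FreeGroup.isReduced_toWord.invRev) j i).2
  rw [List.append_nil, ← FreeGroup.toWord_inv] at this
  exact this.symm

theorem eq_one_of_gpos_eq_q {g : FreeGroup X} {i j : ℤ} (h : S.gpos g i = S.q j) : g = 1 := by
  rw [← FreeGroup.toWord_eq_nil_iff]
  rw [gpos] at h
  cases hg : g.toWord with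
  | nil => rfl
  | cons l L =>
    rw [hg] at h
    exact absurd h (S.e_ne_q _ _ _)

theorem gpos_map {Y C : Type*} [DecidableEq Y] [LinearOrder C] (T : CutSystem Y C) (σ : X ≃ Y)
    (s : B → C) (hs : StrictMono s) (n : ℤ) (hq : ∀ i, s (S.q i) = T.q (i + n))
    (he : ∀ x b i, s (S.e (x, b) i) = T.e (σ x, b) (i + n)) (g : FreeGroup X) (j : ℤ) :
    T.gpos (FreeGroup.map σ g) (j + n) = s (S.gpos g j) := by
  have : (FreeGroup.map σ g).toWord = g.toWord.map fun l => (σ l.1, l.2) := by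
    conv_lhs => rw [← FreeGroup.mk_toWord (x := g)]
    rw [FreeGroup.map.mk, FreeGroup.toWord_mk]
    refine FreeGroup.IsReduced.reduce_eq ?_
    refine List.isChain_map_of_isChain (R := fun a b : X × Bool => a.1 = b.1 → a.2 = b.2) _ ?_
      FreeGroup.isReduced_toWord
    exact fun a b h h' => h (σ.injective h')
  rw [gpos, this, S.pos_map T σ s hs n hq he]
  rfl

end CutSystem

/-! ### The cut system of a periodic word. -/

/-- The linear order that carries the cut systems of periodic words: the first coordinate is a
level, the second a letter with one of its two orders. -/
abbrev CutOrder (X : Type*) := ℤ ×ₗ (WithBot (X ⊕ₗ Xᵒᵈ) ×ₗ ℤ)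

namespace CutOrder

variable {X : Type*}

/-- An element of `X` in one of the two orders on `X`. -/
def signed (s : Bool) (x : X) : WithBot (X ⊕ₗ Xᵒᵈ) :=
  ((if s then toLex (Sum.inl x) else toLex (Sum.inr (OrderDual.toDual x)) : X ⊕ₗ Xᵒᵈ))

/-- The element of level `c`. -/
def mk (c : ℤ) (y : WithBot (X ⊕ₗ Xᵒᵈ)) (i : ℤ) : CutOrder X := toLex (c, toLex (y, i))

theorem mk_lt_mk [LinearOrder X] {c c' i i' : ℤ} {y y' : WithBot (X ⊕ₗ Xᵒᵈ)} :
    mk c y i < mk c' y' i' ↔ c < c' ∨ c = c' ∧ (y < y' ∨ y = y' ∧ i < i') := by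
  simp [mk, Prod.Lex.toLex_lt_toLex]

theorem mk_inj {c c' i i' : ℤ} {y y' : WithBot (X ⊕ₗ Xᵒᵈ)} :
    mk c y i = mk c' y' i' ↔ c = c' ∧ y = y' ∧ i = i' := by
  simp [mk]

theorem signed_injective (s : Bool) : Function.Injective (signed s : X → _) := by
  intro x y h
  cases s <;> simpa [signed] using h

theorem signed_ne_bot (s : Bool) (x : X) : signed s x ≠ ⊥ := WithBot.coe_ne_bot

theorem signed_true_lt [LinearOrder X] {x y : X} : signed true x < signed true y ↔ x < y := by
  simp [signed]

theorem signed_false_lt [LinearOrder X] {x y : X} : signed false x < signed false y ↔ y < x := by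
  simp [signed]

/-- Translation by `n` combined with an automorphism of `X`. -/
def shift [LinearOrder X] (σ : X ≃o X) (n : ℤ) (u : CutOrder X) : CutOrder X :=
  mk ((ofLex u).1 + 3 * n) ((σ.sumLexCongr σ.dual).withBotCongr (ofLex (ofLex u).2).1)
    ((ofLex (ofLex u).2).2 + n)

theorem shift_mk [LinearOrder X] (σ : X ≃o X) (n : ℤ) (c i : ℤ) (y : WithBot (X ⊕ₗ Xᵒᵈ)) :
    shift σ n (mk c y i) =
      mk (c + 3 * n) ((σ.sumLexCongr σ.dual).withBotCongr y) (i + n) := rfl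

theorem exists_eq_mk (u : CutOrder X) : ∃ c y i, u = mk c y i := ⟨_, _, _, rfl⟩

theorem shift_strictMono [LinearOrder X] (σ : X ≃o X) (n : ℤ) : StrictMono (shift σ n) := by
  intro u v h
  obtain ⟨c, y, i, rfl⟩ := exists_eq_mk u
  obtain ⟨c', y', i', rfl⟩ := exists_eq_mk v
  rw [shift_mk, shift_mk]
  rw [mk_lt_mk] at h ⊢
  rw [OrderIso.lt_iff_lt, EmbeddingLike.apply_eq_iff_eq]
  simpa using h

theorem congr_signed [LinearOrder X] (σ : X ≃o X) (s : Bool) (x : X) :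
    (σ.sumLexCongr σ.dual).withBotCongr (signed s x) = signed s (σ x) := by
  cases s <;> rfl

/-- The level of the block `i` of the letters of sign `b`, in the cut system of a periodic word with
signs `d`. -/
def level (d : ℤ → Bool) (b : Bool) (i : ℤ) : ℤ :=
  -- The marked points `q i` have level `3 * i`. A block `i` of sign `d i` falls in the gap before
  -- `q i`, one of the opposite sign in the gap after it. There it shares the level of the blocks `i
  -- + 1` of sign `d (i + 1)` if the signs agree, and lies above them otherwise.
  if b = d i then 3 * i - 2 else if b = d (i + 1) then 3 * i + 1 else 3 * i + 2

/-- The index of the class to which the block `i` of the letters of sign `b` belongs, in the cut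
system of a periodic word with signs `d`. -/
def cls (d : ℤ → Bool) (b : Bool) (i : ℤ) : ℤ := if b = d i then i - 1 else i

theorem le_level (d : ℤ → Bool) (b : Bool) (i : ℤ) : 3 * i - 2 ≤ level d b i := by
  unfold level; split_ifs <;> omega

theorem level_le (d : ℤ → Bool) (b : Bool) (i : ℤ) : level d b i ≤ 3 * i + 2 := by
  unfold level; split_ifs <;> omega

theorem isIntChain_mk [LinearOrder X] {c : ℤ → ℤ} {y : ℤ → WithBot (X ⊕ₗ Xᵒᵈ)}
    (h₁ : ∀ i, 3 * i - 2 ≤ c i) (h₂ : ∀ i, c i ≤ 3 * i + 2)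
    (h : ∀ i, mk (c i) (y i) i < mk (c (i + 1)) (y (i + 1)) (i + 1)) :
    IsIntChain fun i => mk (c i) (y i) i where
  strictMono := strictMono_int_of_lt_succ h
  exists_lt u := by
    obtain ⟨k, y, i, rfl⟩ := exists_eq_mk u
    refine ⟨-|k| - 1, mk_lt_mk.2 (Or.inl ?_)⟩
    have := h₂ (-|k| - 1)
    have := neg_abs_le k
    have := abs_nonneg k
    omega
  exists_gt u := by
    obtain ⟨k, y, i, rfl⟩ := exists_eq_mk u
    refine ⟨|k| + 3, mk_lt_mk.2 (Or.inl ?_)⟩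
    have := h₁ (|k| + 3)
    have := le_abs_self k
    have := abs_nonneg k
    omega

/-- The cut system of a periodic word with signs `d`, where `s` tells which of the two orders on `X`
is used in each class. -/
def cutSystem [LinearOrder X] (d s : ℤ → Bool) : CutSystem X (CutOrder X) where
  q i := mk (3 * i) ⊥ i
  e l i := mk (level d l.2 i) (signed (s (cls d l.2 i)) l.1) i
  q_chain := isIntChain_mk (fun i => by omega) (fun i => by omega)
    fun i => mk_lt_mk.2 (Or.inl (by omega))
  e_chain l := isIntChain_mk (le_level d _) (level_le d _) fun i => by
    rw [mk_lt_mk]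
    by_cases h₁ : l.2 = d i
    · refine Or.inl ?_
      have := le_level d l.2 (i + 1)
      rw [level, if_pos h₁]
      omega
    -- Here the blocks `i` and `i + 1` share level and class, hence the order on `X`, and only the
    -- last coordinate separates them.
    by_cases h₂ : l.2 = d (i + 1)
    · refine Or.inr ?_
      simp only [level, cls, if_neg h₁, if_pos h₂]
      refine ⟨by ring, Or.inr ⟨?_, by omega⟩⟩
      rw [add_sub_cancel_right]
    · refine Or.inl ?_
      rw [level, if_neg h₁, if_neg h₂, level, if_neg h₂]
      split_ifs <;> omega
  e_ne_q l i j h := signed_ne_bot _ _ (mk_inj.1 h).2.1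
  e_inj l m i j h := by
    obtain ⟨x, b⟩ := l
    obtain ⟨y, b'⟩ := m
    obtain ⟨h₁, h₂, rfl⟩ := mk_inj.1 h
    have hb : b = b' := by
      by_contra hb
      simp only [level] at h₁
      cases b <;> cases b' <;> cases hd : d i <;> simp_all <;> split_ifs at h₁ <;> omega
    subst hb
    exact Prod.ext (signed_injective _ h₂) rfl

variable [LinearOrder X]

theorem gpos_map [DecidableEq X] (d s : ℤ → Bool) (n : ℤ)
    (hd : ∀ i, d (i + n) = d i) (hs : ∀ i, s (i + n) = s i) (σ : X ≃o X) (g : FreeGroup X) (j : ℤ) :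
    (cutSystem d s).gpos (FreeGroup.map σ g) (j + n) = shift σ n ((cutSystem d s).gpos g j) := by
  refine CutSystem.gpos_map _ _ σ.toEquiv _ (shift_strictMono σ n) n (fun i => ?_)
    (fun x b i => ?_) g j
  · simp only [cutSystem, shift_mk]
    rw [mul_add]
    rfl
  · simp only [cutSystem, shift_mk, congr_signed]
    have h : i + n + 1 = i + 1 + n := by ring
    have h₁ : level d b (i + n) = level d b i + 3 * n := by
      simp only [level, hd, h]
      split_ifs <;> ring
    have h₂ : s (cls d b (i + n)) = s (cls d b i) := by
      simp only [cls, hd]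
      split_ifs
      · rw [← hs (i - 1)]; congr 1; ring
      · exact hs i
    rw [h₁, h₂]
    rfl

theorem shift_zero_lt_q_iff (d s : ℤ → Bool) (σ : X ≃o X) (u : CutOrder X) (i : ℤ) :
    shift σ 0 u < (cutSystem d s).q i ↔ u < (cutSystem d s).q i := by
  rw [← (shift_strictMono σ 0).lt_iff_lt (a := u)]
  have : shift σ 0 ((cutSystem d s).q i) = (cutSystem d s).q i := by
    simp only [cutSystem, shift_mk, mul_zero, add_zero]
    rfl
  rw [this]

end CutOrder

open CutOrder in
/-- The free group on a linearly ordered set has a left-invariant linear order that is invariant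
under the automorphisms of the ordered set of generators. -/
theorem FreeGroup.exists_positive_cone (X : Type*) [LinearOrder X] :
    ∃ P : Submonoid (FreeGroup X), (∀ g, g ∈ P ∨ g⁻¹ ∈ P) ∧ (∀ g ∈ P, g⁻¹ ∈ P → g = 1) ∧
      ∀ (σ : X ≃o X), ∀ g ∈ P, FreeGroup.map σ g ∈ P := by
  classical
  -- Any signs would do for the order itself; constant ones suffice. The cone consists of the `g`
  -- whose point `(g, 0)` is not below `(1, 0)`.
  let S : CutSystem X (CutOrder X) := cutSystem (fun _ => true) (fun _ => true)
  refine ⟨⟨⟨{g | S.q 0 ≤ S.gpos g 0}, S.q_le_gpos_mul⟩, ?_⟩, fun g => ?_, fun g h₁ h₂ => ?_,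
    fun σ g hg => ?_⟩
  · simp [CutSystem.gpos]
  · change S.q 0 ≤ S.gpos g 0 ∨ S.q 0 ≤ S.gpos g⁻¹ 0
    rw [← not_lt, ← not_lt, S.gpos_inv_lt_q_iff]
    by_contra! h
    exact lt_asymm h.1 h.2
  · change S.q 0 ≤ S.gpos g⁻¹ 0 at h₂
    rw [← not_lt, S.gpos_inv_lt_q_iff, not_lt] at h₂
    exact S.eq_one_of_gpos_eq_q (le_antisymm h₂ h₁)
  · change S.q 0 ≤ S.gpos (FreeGroup.map σ g) 0
    have := CutOrder.gpos_map (fun _ => true) (fun _ => true) 0 (fun _ => rfl) (fun _ => rfl) σ g 0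
    rw [add_zero] at this
    rw [this, ← not_lt, shift_zero_lt_q_iff, not_lt]
    exact hg

/-! ### Defect-one functions on free groups. -/

/-- An integer-valued function on a group whose defect takes only the values `0` and `1`. -/
def IsDefectOne {G : Type*} [Group G] (φ : G → ℤ) : Prop :=
  ∀ g h, φ g + φ h ≤ φ (g * h) ∧ φ (g * h) ≤ φ g + φ h + 1

/-- The subword from position `k` of length `m` of a bi-infinite word. -/
def subword {X : Type*} (l : ℤ → X × Bool) (k : ℤ) (m : ℕ) : List (X × Bool) :=
  (List.range m).map fun t : ℕ => l (k + t + 1)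

theorem subword_succ {X : Type*} (l : ℤ → X × Bool) (k : ℤ) (m : ℕ) :
    subword l k (m + 1) = l (k + 1) :: subword l (k + 1) m := by
  simp only [subword, List.range_succ_eq_map, List.map_cons, List.map_map]
  simp only [Nat.cast_zero, add_zero, List.cons.injEq, true_and]
  refine List.map_congr_left fun t _ => ?_
  simp only [Function.comp, Nat.succ_eq_add_one, Nat.cast_add, Nat.cast_one]
  congr 1
  ring

theorem subword_add {X : Type*} (l : ℤ → X × Bool) (n : ℕ) (hl : ∀ i, l (i + n) = l i) (k : ℤ)
    (m : ℕ) : subword l k (n + m) = subword l k n ++ subword l k m := by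
  simp only [subword, List.range_add, List.map_append, List.map_map]
  congr 1
  refine List.map_congr_left fun t _ => ?_
  simp only [Function.comp, Nat.cast_add]
  rw [← hl (k + t + 1)]
  congr 1
  ring

theorem isReduced_subword {X : Type*} (l : ℤ → X × Bool)
    (hl : ∀ i, (l i).1 = (l (i + 1)).1 → (l i).2 = (l (i + 1)).2) (k : ℤ) (m : ℕ) :
    FreeGroup.IsReduced (subword l k m) := by
  induction m generalizing k with
  | zero => simp [subword]
  | succ m ih =>
    rw [subword_succ]
    cases m with
    | zero => simp [subword]
    | succ m =>
      have := ih (k + 1)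
      rw [subword_succ] at this ⊢
      exact List.isChain_cons_cons.2 ⟨hl _, this⟩

theorem mk_subword_mul {X : Type*} (l : ℤ → X × Bool) (n : ℕ) (hl : ∀ i, l (i + n) = l i) (N : ℕ) :
    FreeGroup.mk (subword l 0 (n * N)) = FreeGroup.mk (subword l 0 n) ^ N := by
  induction N with
  | zero => simp [subword, FreeGroup.one_eq_mk]
  | succ N ih => rw [mul_add_one, add_comm, subword_add l n hl, ← FreeGroup.mul_mk, ih, pow_succ']

open CutOrder in
/-- A power of a cyclically reduced word translates the fibre over `1` by at least the power. -/
theorem FreeGroup.exists_isDefectOne {X : Type*} [LinearOrder X] (l : ℤ → X × Bool) (n : ℕ)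
    (hn : 0 < n) (hl : ∀ i, l (i + n) = l i)
    (hred : ∀ i, (l i).1 = (l (i + 1)).1 → (l i).2 = (l (i + 1)).2) :
    ∃ φ : FreeGroup X → ℤ, IsDefectOne φ ∧ (∀ (σ : X ≃o X) (g), φ (FreeGroup.map σ g) = φ g) ∧
      ∀ N : ℕ, φ (FreeGroup.mk (subword l 0 n) ^ N) ≤ -N := by
  classical
  let d : ℤ → Bool := fun i => (l i).2
  -- Where consecutive letters have opposite signs, their blocks share a level; `s i` picks the
  -- order on `X` that puts the generator of `l (i + 1)` before that of `l i`.
  let s : ℤ → Bool := fun i => decide ((l (i + 1)).1 < (l i).1)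
  have hd : ∀ i, d (i + n) = d i := fun i => by simp only [d, hl]
  have hs : ∀ i, s (i + n) = s i := fun i => by
    simp only [s, hl]
    rw [show i + (n : ℤ) + 1 = i + 1 + n by ring, hl]
  let S : CutSystem X (CutOrder X) := cutSystem d s
  have hq : IsIntChain fun m : ℤ => S.q (n * m) := by
    have hn' : (0 : ℤ) < n := by exact_mod_cast hn
    refine ⟨S.q_chain.strictMono.comp fun a b h => mul_lt_mul_of_pos_left h hn', fun u => ?_,
      fun u => ?_⟩
    · obtain ⟨i, hi⟩ := S.q_chain.exists_lt u
      refine ⟨-|i|, (S.q_chain.strictMono.monotone ?_).trans_lt hi⟩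
      nlinarith [neg_abs_le i, abs_nonneg i]
    · obtain ⟨i, hi⟩ := S.q_chain.exists_gt u
      refine ⟨|i|, hi.trans_le (S.q_chain.strictMono.monotone ?_)⟩
      nlinarith [le_abs_self i, abs_nonneg i]
  have shift_q (m i : ℤ) : shift (OrderIso.refl X) m (S.q i) = S.q (i + m) := by
    simp only [S, cutSystem, shift_mk, mul_add]
    rfl
  have hdm (m i : ℤ) : d (i + n * m) = d i := by
    have := (show Function.Periodic d (n : ℤ) from hd).int_mul m i
    rwa [mul_comm] at this
  have hsm (m i : ℤ) : s (i + n * m) = s i := by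
    have := (show Function.Periodic s (n : ℤ) from hs).int_mul m i
    rwa [mul_comm] at this
  have gpos_shift (g : FreeGroup X) (j m : ℤ) :
      S.gpos g (j + n * m) = shift (OrderIso.refl X) (n * m) (S.gpos g j) := by
    have := CutOrder.gpos_map d s (n * m) (hdm m) (hsm m) (OrderIso.refl X) g j
    rwa [show FreeGroup.map (OrderIso.refl X) g = g from FreeGroup.map.id g] at this
  have le_shift (g : FreeGroup X) (i j m : ℤ) :
      S.q (i + n * m) ≤ S.gpos g (j + n * m) ↔ S.q i ≤ S.gpos g j := by
    rw [gpos_shift, ← shift_q, (shift_strictMono _ _).le_iff_le]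
  have hφ (g : FreeGroup X) (m : ℤ) : m ≤ hq.floor (S.gpos g 0) ↔ S.q (n * m) ≤ S.gpos g 0 :=
    hq.le_iff_le_floor.symm
  -- The two defect inequalities are transitivity of the order, after shifting the comparison for
  -- `g` by `n * b` or `n * (b + 1)` along the fibres.
  refine ⟨fun g => hq.floor (S.gpos g 0), fun g h => ⟨?_, ?_⟩, fun σ g => ?_, fun N => ?_⟩
  · rw [hφ]
    have h₁ := (hφ g _).1 le_rfl
    have h₂ := (hφ h _).1 le_rfl
    set a := hq.floor (S.gpos g 0)
    set b := hq.floor (S.gpos h 0)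
    rw [← le_shift g _ _ b] at h₁
    rw [zero_add] at h₁
    rw [mul_add]
    exact S.q_le_gpos_mul h₁ h₂
  · have h₁ := not_le.1 (mt (hφ g _).2 (lt_add_one _).not_ge)
    have h₂ := not_le.1 (mt (hφ h _).2 (lt_add_one _).not_ge)
    set a := hq.floor (S.gpos g 0)
    set b := hq.floor (S.gpos h 0)
    rw [← not_le, ← le_shift g _ _ (b + 1), zero_add, not_le] at h₁
    have := S.gpos_mul_lt_q h₁ h₂
    rw [← not_le, ← mul_add, ← hφ] at this
    change hq.floor (S.gpos (g * h) 0) ≤ a + b + 1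
    omega
  · refine eq_of_forall_le_iff fun m => ?_
    have := CutOrder.gpos_map d s 0 (fun i => by rw [add_zero]) (fun i => by rw [add_zero]) σ g 0
    rw [add_zero] at this
    rw [hφ, hφ]
    change S.q _ ≤ (cutSystem d s).gpos _ _ ↔ _
    rw [this, ← not_lt, ← not_lt]
    exact not_congr (shift_zero_lt_q_iff d s σ _ _)
  · have q_lt (k : ℤ) : S.q k < S.e (invLetter (l k)) k := by
      refine mk_lt_mk.2 (Or.inl ?_)
      simp only [level, invLetter, d, Bool.not_eq_eq_eq_not, Bool.eq_not_self, if_false]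
      split_ifs <;> omega
    have lt_q (k : ℤ) : S.e (invLetter (l k)) k < S.q (k + 1) := by
      refine mk_lt_mk.2 (Or.inl ?_)
      have := level_le d (invLetter (l k)).2 k
      omega
    -- The choice of `level` and `s` is made for this inequality: equal consecutive signs are
    -- settled by the level, opposite ones by `s k`, the generators then being distinct because the
    -- word is reduced.
    have step (k : ℤ) : S.e (l (k + 1)) (k + 1) < S.e (invLetter (l k)) k := by
      have hne : ¬ (invLetter (l k)).2 = d k := by simp [invLetter, d]
      refine mk_lt_mk.2 ?_
      have h₁ : level d (l (k + 1)).2 (k + 1) = 3 * k + 1 := by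
        simp only [level, d, if_true]; ring
      have h₂ : cls d (l (k + 1)).2 (k + 1) = k := by simp [cls, d]
      have h₃ : cls d (invLetter (l k)).2 k = k := by rw [cls, if_neg hne]
      rw [h₁, h₂, h₃, level, if_neg hne]
      split_ifs with h
      · refine Or.inr ⟨rfl, Or.inl ?_⟩
        have hx : (l (k + 1)).1 ≠ (l k).1 := fun hx => by
          have := hred k hx.symm
          simp [invLetter, d, this] at h
        by_cases hlt : (l (k + 1)).1 < (l k).1
        · rw [show s k = true from decide_eq_true hlt]
          exact signed_true_lt.2 hlt
        · rw [show s k = false from decide_eq_false hlt]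
          exact signed_false_lt.2 (lt_of_le_of_ne (not_lt.1 hlt) hx.symm)
      · exact Or.inl (by omega)
    -- The bound does not depend on `m`: each letter read raises the fibre index by one without
    -- passing the block behind the starting vertex.
    have key (m : ℕ) : ∀ k : ℤ, S.pos (subword l k m) (k + m) < S.e (invLetter (l k)) k := by
      induction m with
      | zero => intro k; simpa [subword] using q_lt k
      | succ m ih =>
        intro k
        rw [subword_succ, CutSystem.pos_cons]
        refine lt_of_le_of_lt (S.e_transfer_le ?_) (step k)
        have := ih (k + 1)
        rwa [show k + 1 + (m : ℤ) = k + (m + 1 : ℕ) by push_cast; ring] at this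
    -- With `f` the word of one period, the point `(f ^ N, n * N)` is below `(1, 1)`. If `φ (f ^ N)`
    -- exceeded `-N`, shifting by `n * N` would put it at or above `(1, n)`, contradicting `1 ≤ n`.
    have h₁ := (key (n * N) 0).trans (lt_q 0)
    rw [← not_lt, not_lt, ← Int.lt_add_one_iff, ← not_le, hφ]
    intro h₂
    rw [← le_shift _ _ _ (N : ℤ), zero_add, ← mk_subword_mul l n hl, CutSystem.gpos,
      FreeGroup.toWord_mk, (isReduced_subword l hred _ _).reduce_eq] at h₂
    push_cast at h₁
    simp only [zero_add] at h₁
    have h₃ := h₂.trans_lt h₁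
    rw [S.q_chain.strictMono.lt_iff_lt] at h₃
    have : (1 : ℤ) ≤ n := by exact_mod_cast hn
    nlinarith

/-- The cyclic reduction of `f`, repeated in both directions, is the bi-infinite word; cyclic
reducedness takes care of the seams between periods. -/
theorem FreeGroup.exists_conj_subword {X : Type*} (f : FreeGroup X) (hf : f ≠ 1) :
    ∃ (c : FreeGroup X) (l : ℤ → X × Bool) (n : ℕ), 0 < n ∧ (∀ i, l (i + n) = l i) ∧
      (∀ i, (l i).1 = (l (i + 1)).1 → (l i).2 = (l (i + 1)).2) ∧
      f = c * FreeGroup.mk (subword l 0 n) * c⁻¹ := by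
  classical
  let L := FreeGroup.reduceCyclically f.toWord
  have hL : FreeGroup.IsCyclicallyReduced L :=
    FreeGroup.reduceCyclically.isCyclicallyReduced FreeGroup.isReduced_toWord
  have hfL : f = FreeGroup.mk (FreeGroup.reduceCyclically.conjugator f.toWord) *
      FreeGroup.mk L * (FreeGroup.mk (FreeGroup.reduceCyclically.conjugator f.toWord))⁻¹ := by
    rw [FreeGroup.inv_mk, FreeGroup.mul_mk, FreeGroup.mul_mk,
      FreeGroup.reduceCyclically.conj_conjugator_reduceCyclically, FreeGroup.mk_toWord]
  have hne : L ≠ [] := fun h => hf <| by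
    rw [hfL, h, ← FreeGroup.one_eq_mk, mul_one, mul_inv_cancel]
  have hn : 0 < L.length := List.length_pos_iff.2 hne
  have hn' : (0 : ℤ) < L.length := by exact_mod_cast hn
  have hmod (i : ℤ) : ((i - 1) % L.length).toNat < L.length := by
    have h₁ := Int.emod_nonneg (i - 1) hn'.ne'
    have h₂ := Int.emod_lt_of_pos (i - 1) hn'
    omega
  have hget {a b : ℕ} (ha : a < L.length) (hb : b < L.length) (hab : a = b) : L[a] = L[b] := by
    subst hab; rfl
  refine ⟨FreeGroup.mk (FreeGroup.reduceCyclically.conjugator f.toWord),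
    -- The index is `i - 1` because `subword l 0 n` starts at position `1`.
    fun i => L[((i - 1) % L.length).toNat]'(hmod i), L.length, hn, fun i => ?_,
    fun i => ?_, ?_⟩
  rotate_left 2
  · convert hfL using 4
    refine List.ext_getElem (by simp [subword]) fun t h₁ h₂ => ?_
    simp only [subword, List.getElem_map, List.getElem_range]
    congr 1
    rw [zero_add, add_sub_cancel_right, Int.emod_eq_of_lt (by omega) (by exact_mod_cast h₂),
      Int.toNat_natCast]
  · refine hget _ _ (congrArg Int.toNat ?_)
    rw [add_sub_right_comm, Int.add_emod_right]
  · have h₂ : FreeGroup.IsReduced (L ++ L) := by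
      have := (hL.flatten_replicate 2).isReduced
      simpa [List.replicate_succ] using this
    have hr := hmod i
    have key := List.isChain_iff_getElem.1 h₂ ((i - 1) % L.length).toNat
      (by rw [List.length_append]; omega)
    rw [List.getElem_append_left hr] at key
    have : (L ++ L)[((i - 1) % L.length).toNat + 1]'(by rw [List.length_append]; omega) =
        L[((i + 1 - 1) % L.length).toNat]'(hmod (i + 1)) := by
      have h₀ := Int.emod_nonneg (i - 1) hn'.ne'
      have hi : (i + 1 - 1) % (L.length : ℤ) = ((i - 1) % L.length + 1) % L.length := by
        rw [Int.emod_add_emod]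
        congr 1
        ring
      by_cases hlt : ((i - 1) % L.length).toNat + 1 < L.length
      · rw [List.getElem_append_left hlt]
        refine hget _ _ ?_
        rw [hi]
        generalize (i - 1) % (L.length : ℤ) = r at h₀ hlt ⊢
        rw [Int.emod_eq_of_lt (by omega) (by omega)]
        omega
      · have heq : ((i - 1) % L.length).toNat + 1 = L.length := by omega
        rw [List.getElem_append_right (by omega)]
        refine hget _ _ ?_
        rw [hi, show (i - 1) % (L.length : ℤ) + 1 = L.length by omega, Int.emod_self]
        omega
    rwa [this] at key

/-! ### Extension to semidirect products. -/

theorem IsDefectOne.comp {G H : Type*} [Group G] [Group H] {φ : H → ℤ} (hφ : IsDefectOne φ)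
    (f : G →* H) : IsDefectOne fun g => φ (f g) := fun g h => by
  simpa only [map_mul] using hφ (f g) (f h)

/-- The action on the free group on `X` induced by an action on `X`. -/
def freeGroupAut (G X : Type*) [Group G] [MulAction G X] : G →* MulAut (FreeGroup X) where
  toFun g := FreeGroup.freeGroupCongr (MulAction.toPerm g)
  map_one' := by
    refine MulEquiv.toMonoidHom_injective (FreeGroup.ext_hom _ _ fun x => ?_)
    simp [MulAut.one_apply]
  map_mul' g h := by
    refine MulEquiv.toMonoidHom_injective (FreeGroup.ext_hom _ _ fun x => ?_)
    simp [MulAut.mul_apply, mul_smul]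

theorem freeGroupAut_apply {G X : Type*} [Group G] [MulAction G X] (g : G) (f : FreeGroup X) :
    freeGroupAut G X g f = FreeGroup.map (g • ·) f := rfl

theorem freeGroupAut_of {G X : Type*} [Group G] [MulAction G X] (g : G) (x : X) :
    freeGroupAut G X g (FreeGroup.of x) = FreeGroup.of (g • x) := by
  rw [freeGroupAut_apply, FreeGroup.map.of]

/-- An order-preserving action by order automorphisms. -/
def smulOrderIso {G X : Type*} [Group G] [MulAction G X] [LinearOrder X]
    (h : ∀ (g : G) (x y : X), x ≤ y → g • x ≤ g • y) (g : G) : X ≃o X where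
  toEquiv := MulAction.toPerm g
  map_rel_iff' {x y} := ⟨fun hxy => by simpa using h g⁻¹ _ _ hxy, h g x y⟩

/-- The left coordinate of a product is twisted only by an order automorphism of `X`, which `φ` does
not see, so `φ a.left` keeps defect one. Precomposing with a conjugation reduces to cyclically
reduced words. -/
theorem SemidirectProduct.exists_isDefectOne {G X : Type*} [Group G] [MulAction G X]
    [LinearOrder X] (h : ∀ (g : G) (x y : X), x ≤ y → g • x ≤ g • y) (f : FreeGroup X)
    (hf : f ≠ 1) : ∃ φ : FreeGroup X ⋊[freeGroupAut G X] G → ℤ, IsDefectOne φ ∧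
      ∀ N : ℕ, φ (SemidirectProduct.inl f ^ N) ≤ -N := by
  obtain ⟨c, l, n, hn, hl, hred, rfl⟩ := FreeGroup.exists_conj_subword f hf
  obtain ⟨φ, hφ, hφσ, hφN⟩ := FreeGroup.exists_isDefectOne l n hn hl hred
  have hφ' : IsDefectOne fun a : FreeGroup X ⋊[freeGroupAut G X] G => φ a.left := fun a b => by
    have := hφ a.left (FreeGroup.map (smulOrderIso h a.right) b.left)
    rw [hφσ] at this
    exact this
  refine ⟨_, hφ'.comp (MulAut.conj (SemidirectProduct.inl c⁻¹)).toMonoidHom, fun N => ?_⟩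
  have : (MulAut.conj (SemidirectProduct.inl (φ := freeGroupAut G X) c⁻¹)).toMonoidHom
      (SemidirectProduct.inl (c * FreeGroup.mk (subword l 0 n) * c⁻¹) ^ N) =
      SemidirectProduct.inl (FreeGroup.mk (subword l 0 n) ^ N) := by
    simp only [MulEquiv.toMonoidHom_eq_coe, MonoidHom.coe_coe, MulAut.conj_apply, ← map_pow,
      ← map_inv, ← map_mul, conj_pow]
    congr 1
    group
  rw [this, SemidirectProduct.left_inl]
  exact hφN N

/-! ### Relative convexity. -/

/-- `C` is relatively convex in `H`: the coset space `H ⧸ C` has an `H`-invariant linear order. It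
is given here by its cone `P` of nonnegative elements. -/
def RelConvex {G : Type*} [Group G] (C H : Subgroup G) : Prop :=
  ∃ P : Submonoid G, (∀ h ∈ H, h ∈ P ∨ h⁻¹ ∈ P) ∧ ∀ h ∈ H, h ∈ P ∧ h⁻¹ ∈ P ↔ h ∈ C

theorem RelConvex.refl {G : Type*} [Group G] (H : Subgroup G) : RelConvex H H :=
  ⟨⊤, fun _ _ => Or.inl trivial, fun _ hh => ⟨fun _ => hh, fun _ => ⟨trivial, trivial⟩⟩⟩

/-- The order is lexicographic: first compare cosets of `K`, then cosets of `C` inside `K`. -/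
theorem RelConvex.trans {G : Type*} [Group G] {C K H : Subgroup G}
    (h₁ : RelConvex C K) (h₂ : RelConvex K H) (hCK : C ≤ K) : RelConvex C H := by
  obtain ⟨P, hP, hPC⟩ := h₁
  obtain ⟨Q, hQ, hQK⟩ := h₂
  refine ⟨⟨⟨{h | h ∈ H ∧ h ∈ Q ∧ (h ∈ K → h ∈ P)}, ?_⟩, ?_⟩, fun h hh => ?_, fun h hh => ?_⟩
  · rintro a b ⟨haH, haQ, haP⟩ ⟨hbH, hbQ, hbP⟩
    refine ⟨mul_mem haH hbH, mul_mem haQ hbQ, fun hab => ?_⟩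
    -- If a product of two nonnegative elements lies in `K`, so does each factor, since `a⁻¹ = b *
    -- (a * b)⁻¹` is nonnegative too.
    have haK : a ∈ K := (hQK a haH).1 ⟨haQ, by
      have := mul_mem hbQ ((hQK _ (mul_mem haH hbH)).2 hab).2
      rwa [mul_inv_rev, mul_inv_cancel_left] at this⟩
    exact mul_mem (haP haK) (hbP ((mul_mem_cancel_left haK).1 hab))
  · exact ⟨one_mem H, one_mem Q, fun _ => one_mem P⟩
  · by_cases hK : h ∈ K
    · have hK' := (hQK h hh).2 hK
      exact (hP h hK).imp (fun h' => ⟨hh, hK'.1, fun _ => h'⟩)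
        fun h' => ⟨inv_mem hh, hK'.2, fun _ => h'⟩
    · exact (hQ h hh).imp (fun h' => ⟨hh, h', fun h => absurd h hK⟩)
        fun h' => ⟨inv_mem hh, h', fun h => absurd (inv_mem_iff.1 h) hK⟩
  · constructor
    · rintro ⟨⟨-, h₁, h₂⟩, -, h₃, h₄⟩
      have hK := (hQK h hh).1 ⟨h₁, h₃⟩
      exact (hPC h hK).1 ⟨h₂ hK, h₄ (inv_mem hK)⟩
    · intro hC
      have hK := hCK hC
      have h₁ := (hQK h hh).2 hK
      have h₂ := (hPC h hK).2 hC
      exact ⟨⟨hh, h₁.1, fun _ => h₂.1⟩, inv_mem hh, h₁.2, fun _ => h₂.2⟩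

theorem RelConvex.exists_linearOrder {G : Type*} [Group G] {C H : Subgroup G}
    (h : RelConvex C H) : ∃ _ : LinearOrder (H ⧸ C.subgroupOf H),
      ∀ (g : H) (x y : H ⧸ C.subgroupOf H), x ≤ y → g • x ≤ g • y := by
  classical
  obtain ⟨P, hP, hPC⟩ := h
  let r (x y : H ⧸ C.subgroupOf H) : Prop :=
    ∃ a b : H, (a : H ⧸ C.subgroupOf H) = x ∧ (b : H ⧸ C.subgroupOf H) = y ∧ ((a⁻¹ * b : H) : G) ∈ P
  have hr (a b : H) : r a b ↔ ((a⁻¹ * b : H) : G) ∈ P := by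
    refine ⟨?_, fun h => ⟨a, b, rfl, rfl, h⟩⟩
    rintro ⟨a', b', ha, hb, h⟩
    rw [QuotientGroup.eq, Subgroup.mem_subgroupOf] at ha hb
    have h₁ := ((hPC _ (SetLike.coe_mem _)).2 ha).2
    have h₂ := ((hPC _ (SetLike.coe_mem _)).2 hb).1
    have := mul_mem (mul_mem h₁ h) h₂
    convert this using 1
    push_cast
    group
  let o : LinearOrder (H ⧸ C.subgroupOf H) :=
    { le := r
      le_refl := by
        rintro ⟨a⟩
        exact (hr a a).2 (by simp)
      le_trans := by
        rintro ⟨a⟩ ⟨b⟩ ⟨c⟩ h₁ h₂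
        refine (hr a c).2 ?_
        have := mul_mem ((hr a b).1 h₁) ((hr b c).1 h₂)
        convert this using 1
        push_cast
        group
      le_antisymm := by
        rintro ⟨a⟩ ⟨b⟩ h₁ h₂
        refine QuotientGroup.eq.2 ?_
        rw [Subgroup.mem_subgroupOf]
        refine (hPC _ (SetLike.coe_mem _)).1 ⟨(hr a b).1 h₁, ?_⟩
        convert (hr b a).1 h₂ using 1
        push_cast
        group
      le_total := by
        rintro ⟨a⟩ ⟨b⟩
        refine (hP _ (SetLike.coe_mem (a⁻¹ * b))).imp (hr a b).2 fun h => (hr b a).2 ?_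
        convert h using 1
        push_cast
        group
      toDecidableLE := fun _ _ => Classical.propDecidable _ }
  refine ⟨o, ?_⟩
  rintro g ⟨a⟩ ⟨b⟩ h
  refine (hr (g * a) (g * b)).2 ?_
  convert (hr a b).1 h using 1
  push_cast
  group

/-! ### Parabolic subgroups and their splittings. -/

namespace RAAG

variable {V : Type*} {Γ : SimpleGraph V}

/-- The generator of a right-angled Artin group given by a vertex. -/
def of (v : V) : RAAG Γ := PresentedGroup.of v

theorem commute_of {v w : V} (h : Γ.Adj v w) : Commute (of v : RAAG Γ) (of w) := by
  have := PresentedGroup.one_of_mem (rels := raagRelators Γ)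
    (x := ⁅FreeGroup.of v, FreeGroup.of w⁆) ⟨v, w, h, rfl⟩
  rw [map_commutatorElement] at this
  exact commutatorElement_eq_one_iff_commute.1 this

/-- The homomorphism given by the images of the generators. -/
def lift {G : Type*} [Group G] (f : V → G) (hf : ∀ v w, Γ.Adj v w → Commute (f v) (f w)) :
    RAAG Γ →* G :=
  PresentedGroup.toGroup (f := f) (by
    rintro _ ⟨v, w, h, rfl⟩
    rw [map_commutatorElement, FreeGroup.lift_apply_of, FreeGroup.lift_apply_of]
    exact commutatorElement_eq_one_iff_commute.2 (hf v w h))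

@[simp] theorem lift_of {G : Type*} [Group G] (f : V → G)
    (hf : ∀ v w, Γ.Adj v w → Commute (f v) (f w)) (v : V) : lift f hf (of v) = f v :=
  PresentedGroup.toGroup.of _

theorem hom_ext {G : Type*} [Group G] {f g : RAAG Γ →* G} (h : ∀ v, f (of v) = g (of v)) :
    f = g := PresentedGroup.ext h

open Classical in
/-- The endomorphism that kills the vertices outside `S`. -/
noncomputable def retraction (Γ : SimpleGraph V) (S : Set V) : RAAG Γ →* RAAG Γ :=
  lift (fun v => if v ∈ S then of v else 1) fun v w h => by
    split_ifs
    · exact commute_of h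
    · exact Commute.one_right _
    · exact Commute.one_left _
    · exact Commute.one_left _

theorem retraction_of_mem {S : Set V} {v : V} (h : v ∈ S) : retraction Γ S (of v) = of v := by
  simp [retraction, h]

theorem retraction_of_notMem {S : Set V} {v : V} (h : v ∉ S) : retraction Γ S (of v) = 1 := by
  simp [retraction, h]

theorem retraction_retraction {S T : Set V} (h : T ⊆ S) (a : RAAG Γ) :
    retraction Γ S (retraction Γ T a) = retraction Γ T a := by
  rw [← MonoidHom.comp_apply]
  congr 1
  refine hom_ext fun v => ?_
  by_cases hT : v ∈ T
  · simp [retraction_of_mem hT, retraction_of_mem (h hT)]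
  · simp [retraction_of_notMem hT]

/-- The subgroup generated by the vertices in `S`. -/
noncomputable def parabolic (Γ : SimpleGraph V) (S : Set V) : Subgroup (RAAG Γ) :=
  (retraction Γ S).range

theorem mem_parabolic {S : Set V} {a : RAAG Γ} : a ∈ parabolic Γ S ↔ retraction Γ S a = a := by
  refine ⟨?_, fun h => ⟨a, h⟩⟩
  rintro ⟨b, rfl⟩
  exact retraction_retraction le_rfl b

theorem parabolic_mono {S T : Set V} (h : T ⊆ S) : parabolic Γ T ≤ parabolic Γ S := by
  intro a ha
  rw [mem_parabolic] at ha ⊢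
  rw [← ha, retraction_retraction h]

theorem of_mem_parabolic {S : Set V} {v : V} (h : v ∈ S) : of v ∈ parabolic Γ S :=
  mem_parabolic.2 (retraction_of_mem h)

theorem commute_of_mem_parabolic {S : Set V} {v : V} (h : ∀ w ∈ S, Γ.Adj v w) {a : RAAG Γ}
    (ha : a ∈ parabolic Γ S) : Commute (of v) a := by
  have : (MulAut.conj (of v)).toMonoidHom.comp (retraction Γ S) = retraction Γ S := by
    refine hom_ext fun w => ?_
    by_cases hw : w ∈ S
    · simp [retraction_of_mem hw, (commute_of (h w hw)).eq]
    · simp [retraction_of_notMem hw]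
  have h₁ := DFunLike.congr_fun this a
  rw [MonoidHom.comp_apply, mem_parabolic.1 ha] at h₁
  simp only [MulEquiv.toMonoidHom_eq_coe, MonoidHom.coe_coe, MulAut.conj_apply] at h₁
  exact mul_inv_eq_iff_eq_mul.1 h₁

/-- The vertices of `S` that are adjacent to `v`. -/
def link (Γ : SimpleGraph V) (S : Set V) (v : V) : Set V := {w ∈ S | Γ.Adj v w}

theorem link_subset (S : Set V) (v : V) : link Γ S v ⊆ S := fun _ h => h.1

/-- The cosets of the link of `v` in `S`: they index the free generators of the kernel of the
retraction from `insert v S` to `S`. -/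
abbrev LinkCosets (Γ : SimpleGraph V) (S : Set V) (v : V) : Type _ :=
  parabolic Γ S ⧸ (parabolic Γ (link Γ S v)).subgroupOf (parabolic Γ S)

/-- The semidirect product that the parabolic subgroup of `insert v S` is isomorphic to. -/
abbrev Splitting (Γ : SimpleGraph V) (S : Set V) (v : V) : Type _ :=
  FreeGroup (LinkCosets Γ S v) ⋊[freeGroupAut (parabolic Γ S) (LinkCosets Γ S v)] parabolic Γ S

theorem commute_inl_inr {S : Set V} {v w : V} (hw : w ∈ S) (h : Γ.Adj v w) :
    Commute (SemidirectProduct.inl (FreeGroup.of ((1 : parabolic Γ S) : LinkCosets Γ S v)) :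
      Splitting Γ S v) (SemidirectProduct.inr ⟨of w, of_mem_parabolic hw⟩) := by
  have h₁ : (⟨of w, of_mem_parabolic hw⟩ : parabolic Γ S) •
      ((1 : parabolic Γ S) : LinkCosets Γ S v) = (1 : parabolic Γ S) := by
    refine QuotientGroup.eq.2 ?_
    rw [Subgroup.mem_subgroupOf]
    simpa using of_mem_parabolic (show w ∈ link Γ S v from ⟨hw, h⟩)
  have h₂ := SemidirectProduct.inl_aut (φ := freeGroupAut (parabolic Γ S) (LinkCosets Γ S v))
    ⟨of w, of_mem_parabolic hw⟩ (FreeGroup.of ((1 : parabolic Γ S) : LinkCosets Γ S v))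
  rw [freeGroupAut_of, h₁, map_inv] at h₂
  exact (eq_mul_inv_iff_mul_eq.1 h₂)

open Classical in
/-- The splitting of the parabolic subgroup of `insert v S`, preceded by the retraction. -/
noncomputable def toSplitting (Γ : SimpleGraph V) (S : Set V) (v : V) :
    RAAG Γ →* Splitting Γ S v :=
  lift (fun w => if h : w ∈ S then SemidirectProduct.inr ⟨of w, of_mem_parabolic h⟩ else
    if w = v then SemidirectProduct.inl (FreeGroup.of ((1 : parabolic Γ S) : LinkCosets Γ S v))
    else 1) fun w w' h => by
      split_ifs with h₁ h₂ h₃ h₄ h₅ h₆ h₇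
      · have : Commute (⟨of w, of_mem_parabolic h₁⟩ : parabolic Γ S)
            ⟨of w', of_mem_parabolic h₂⟩ := Subtype.ext (commute_of h)
        exact this.map SemidirectProduct.inr
      · subst h₃
        exact (commute_inl_inr h₁ h.symm).symm
      · exact Commute.one_right _
      · subst h₄
        exact commute_inl_inr h₅ h
      · exact Commute.refl _
      · exact Commute.one_right _
      all_goals exact Commute.one_left _

/-- The homomorphism on the free kernel that sends a coset `h` to the conjugate of `v` by `h`. -/
noncomputable def ofKernel (Γ : SimpleGraph V) (S : Set V) (v : V) :
    FreeGroup (LinkCosets Γ S v) →* RAAG Γ :=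
  FreeGroup.lift fun x => Quotient.liftOn' x (fun h => (h : RAAG Γ) * of v * (h : RAAG Γ)⁻¹)
    fun a b hab => by
      rw [QuotientGroup.leftRel_apply, Subgroup.mem_subgroupOf] at hab
      have := commute_of_mem_parabolic (v := v) (fun w hw => hw.2) hab
      push_cast at this
      have h₁ : (b : RAAG Γ) = a * ((a : RAAG Γ)⁻¹ * b) := by group
      rw [h₁]
      generalize (a : RAAG Γ)⁻¹ * b = c at this
      rw [mul_inv_rev, mul_assoc (a : RAAG Γ) c, ← this.eq]
      group

theorem ofKernel_of (S : Set V) (v : V) (h : parabolic Γ S) :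
    ofKernel Γ S v (FreeGroup.of (h : LinkCosets Γ S v)) = (h : RAAG Γ) * of v * (h : RAAG Γ)⁻¹ :=
  FreeGroup.lift_apply_of

/-- The inverse of the splitting. -/
noncomputable def ofSplitting (Γ : SimpleGraph V) (S : Set V) (v : V) :
    Splitting Γ S v →* RAAG Γ :=
  SemidirectProduct.lift (ofKernel Γ S v) (parabolic Γ S).subtype fun g => by
    refine FreeGroup.ext_hom _ _ fun x => ?_
    obtain ⟨h, rfl⟩ := QuotientGroup.mk_surjective x
    simp only [MulEquiv.toMonoidHom_eq_coe, MonoidHom.comp_apply, MonoidHom.coe_coe,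
      freeGroupAut_of, ofKernel_of, MulAut.conj_apply]
    rw [MulAction.Quotient.smul_coe, ofKernel_of]
    simp only [smul_eq_mul, Subgroup.coe_mul, Subgroup.subtype_apply]
    group

theorem ofSplitting_toSplitting {S : Set V} {v : V} (hv : v ∉ S) (a : RAAG Γ) :
    ofSplitting Γ S v (toSplitting Γ S v a) = retraction Γ (insert v S) a := by
  rw [← MonoidHom.comp_apply]
  congr 1
  refine hom_ext fun w => ?_
  by_cases hw : w ∈ S
  · simp [toSplitting, hw, ofSplitting, retraction_of_mem (Set.mem_insert_of_mem v hw)]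
  by_cases hwv : w = v
  · subst hwv
    simp [toSplitting, hw, ofSplitting, retraction_of_mem (Set.mem_insert w S), ofKernel_of]
  · rw [retraction_of_notMem (by simp [hw, hwv])]
    simp [toSplitting, hw, hwv]

theorem right_toSplitting {S : Set V} {v : V} (hv : v ∉ S) (a : RAAG Γ) :
    ((toSplitting Γ S v a).right : RAAG Γ) = retraction Γ S a := by
  have : (parabolic Γ S).subtype.comp (SemidirectProduct.rightHom.comp (toSplitting Γ S v)) =
      retraction Γ S := by
    refine hom_ext fun w => ?_
    by_cases hw : w ∈ S
    · simp [toSplitting, hw, retraction_of_mem hw]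
    by_cases hwv : w = v
    · subst hwv
      simp [toSplitting, hw, retraction_of_notMem hw]
    · simp [toSplitting, hw, hwv, retraction_of_notMem hw]
  exact DFunLike.congr_fun this a

/-- In the splitting, an element is declared nonnegative when its free coordinate lies in an
invariant positive cone. It and its inverse are both nonnegative exactly when that coordinate is
trivial, that is, when the element lies in the complement. The hypothesis orders the free
generators. -/
theorem relConvex_parabolic_insert {S : Set V} {v : V} (hv : v ∉ S)
    (h : RelConvex (parabolic Γ (link Γ S v)) (parabolic Γ S)) :
    RelConvex (parabolic Γ S) (parabolic Γ (insert v S)) := by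
  obtain ⟨o, ho⟩ := h.exists_linearOrder
  obtain ⟨P, hP, hP₁, hPσ⟩ := FreeGroup.exists_positive_cone (LinkCosets Γ S v)
  let Q : Submonoid (Splitting Γ S v) :=
    { carrier := {a | a.left ∈ P}
      one_mem' := one_mem P
      mul_mem' := fun {a b} ha hb => mul_mem ha (hPσ (smulOrderIso ho a.right) _ hb) }
  have hinv (a : Splitting Γ S v) : a⁻¹ ∈ Q ↔ a.left⁻¹ ∈ P := by
    constructor
    · intro h
      have := hPσ (smulOrderIso ho a.right) _ h
      change freeGroupAut (parabolic Γ S) (LinkCosets Γ S v) a.right _ ∈ P at this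
      rwa [SemidirectProduct.inv_left, map_inv (freeGroupAut _ _), MulAut.apply_inv_self] at this
    · intro h
      have := hPσ (smulOrderIso ho a.right⁻¹) _ h
      exact this
  refine ⟨Q.comap (toSplitting Γ S v), fun a _ => ?_, fun a ha => ?_⟩
  · rw [Submonoid.mem_comap, Submonoid.mem_comap, map_inv, hinv]
    exact hP _
  · rw [Submonoid.mem_comap, Submonoid.mem_comap, map_inv, hinv]
    constructor
    · rintro ⟨h₁, h₂⟩
      have h₃ := hP₁ _ h₁ h₂
      rw [← mem_parabolic.1 ha, ← ofSplitting_toSplitting hv]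
      have h₄ : toSplitting Γ S v a = SemidirectProduct.inr (toSplitting Γ S v a).right :=
        SemidirectProduct.ext h₃ rfl
      rw [h₄, ofSplitting, SemidirectProduct.lift_inr]
      exact SetLike.coe_mem _
    · intro haS
      have hleft : (toSplitting Γ S v a).left = 1 := by
        have : SemidirectProduct.inr.comp
            (SemidirectProduct.rightHom.comp ((toSplitting Γ S v).comp (retraction Γ S))) =
            (toSplitting Γ S v).comp (retraction Γ S) := by
          refine hom_ext fun w => ?_
          by_cases hw : w ∈ S
          · simp [toSplitting, hw, retraction_of_mem hw]
          · simp [retraction_of_notMem hw]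
        have h₁ := congrArg SemidirectProduct.left (DFunLike.congr_fun this a)
        simp only [MonoidHom.comp_apply, mem_parabolic.1 haS, SemidirectProduct.left_inr] at h₁
        exact h₁.symm
      refine ⟨?_, ?_⟩
      · change (toSplitting Γ S v a).left ∈ P
        rw [hleft]; exact one_mem P
      · rw [hleft, inv_one]; exact one_mem P

/-- Parabolic subgroups are relatively convex in each other. -/
theorem relConvex_parabolic [Finite V] (Γ : SimpleGraph V) (S : Set V) :
    ∀ T ⊆ S, RelConvex (parabolic Γ T) (parabolic Γ S) := by
  induction S using WellFoundedLT.induction with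
  | ind S ih =>
    intro T hT
    by_cases hST : S ⊆ T
    · rw [hST.antisymm hT]
      exact RelConvex.refl _
    · obtain ⟨v, hvS, hvT⟩ := Set.not_subset.1 hST
      have hlt : S \ {v} < S := Set.sdiff_singleton_ssubset.2 hvS
      have hTS : T ⊆ S \ {v} := Set.subset_sdiff_singleton hT hvT
      -- Induction is used twice: for the link of `v`, which orders the generators of the kernel,
      -- and below for `T` in `S \ {v}`.
      have h₁ := relConvex_parabolic_insert (v := v) (by simp) (ih _ hlt _ (link_subset _ v))
      rw [Set.insert_sdiff_self_of_mem hvS] at h₁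
      exact (ih _ hlt T hTS).trans h₁ (parabolic_mono hTS)

theorem retraction_univ : retraction Γ Set.univ = MonoidHom.id _ :=
  hom_ext fun v => retraction_of_mem (Set.mem_univ v)

theorem retraction_empty (a : RAAG Γ) : retraction Γ ∅ a = 1 := by
  have : retraction Γ ∅ = 1 := hom_ext fun v => retraction_of_notMem (Set.notMem_empty v)
  rw [this, MonoidHom.one_apply]

theorem exists_isDefectOne [Finite V] (g : RAAG Γ) (hg : g ≠ 1) :
    ∃ φ : RAAG Γ → ℤ, IsDefectOne φ ∧ ∀ N : ℕ, φ (g ^ N) ≤ -N := by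
  -- By minimality `g` dies in `S \ {v}`, so its image in the splitting is a non-trivial element of
  -- the free kernel.
  obtain ⟨S, hS, hmin⟩ := WellFounded.has_min (wellFounded_lt (α := Set V))
    {S | retraction Γ S g ≠ 1} ⟨Set.univ, by simpa [retraction_univ] using hg⟩
  obtain ⟨v, hv⟩ : S.Nonempty := by
    rw [Set.nonempty_iff_ne_empty]
    rintro rfl
    exact hS (retraction_empty g)
  have hlt : S \ {v} < S := Set.sdiff_singleton_ssubset.2 hv
  have hv' : v ∉ S \ {v} := by simp
  have h₁ : retraction Γ (S \ {v}) g = 1 := by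
    by_contra h
    exact hmin _ h hlt
  have h₂ : toSplitting Γ (S \ {v}) v g ≠ 1 := fun h => hS <| by
    have := ofSplitting_toSplitting hv' g
    rwa [h, map_one, Set.insert_sdiff_self_of_mem hv, eq_comm] at this
  have h₃ : toSplitting Γ (S \ {v}) v g =
      SemidirectProduct.inl (toSplitting Γ (S \ {v}) v g).left := by
    refine SemidirectProduct.ext rfl (Subtype.ext ?_)
    rw [right_toSplitting hv', h₁]
    rfl
  obtain ⟨o, ho⟩ := (relConvex_parabolic Γ (S \ {v}) _ (link_subset _ v)).exists_linearOrder
  obtain ⟨φ, hφ, hN⟩ := SemidirectProduct.exists_isDefectOne ho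
    (toSplitting Γ (S \ {v}) v g).left fun h => h₂ (by rw [h₃, h, map_one])
  refine ⟨_, hφ.comp (toSplitting Γ (S \ {v}) v), fun N => ?_⟩
  rw [map_pow, h₃]
  exact hN N

end RAAG

/-! ### The lower bound for `scl`. -/

namespace IsDefectOne

variable {G : Type*} [Group G] {φ : G → ℤ}

/-- Compare `a * b` with `⁅a, b⁆ * (b * a)`: the upper defect bound is used twice, the lower one
once. -/
theorem neg_two_le_commutator (hφ : IsDefectOne φ) (a b : G) : -2 ≤ φ ⁅a, b⁆ := by
  have h₁ := (hφ ⁅a, b⁆ (b * a)).2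
  have h₂ := (hφ b a).2
  have h₃ := (hφ a b).1
  rw [show ⁅a, b⁆ * (b * a) = a * b by rw [commutatorElement_def]; group] at h₁
  omega

theorem le_of_isProdOfCommutators (hφ : IsDefectOne φ) {g : G} {k : ℕ}
    (h : IsProdOfCommutators g k) : -(2 * k + 1 : ℤ) ≤ φ g := by
  obtain ⟨l, rfl, rfl⟩ := h
  induction l with
  | nil =>
    have := (hφ 1 1).2
    rw [mul_one] at this
    simp only [List.length_nil, List.map_nil, List.prod_nil]
    push_cast
    omega
  | cons p l ih =>
    have h₁ := hφ.neg_two_le_commutator p.1 p.2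
    have h₂ := (hφ ⁅p.1, p.2⁆ (l.map fun p => ⁅p.1, p.2⁆).prod).1
    rw [List.map_cons, List.prod_cons, List.length_cons]
    push_cast
    omega

theorem half_le_scl (hφ : IsDefectOne φ) (g : commutator G)
    (h : ∀ N : ℕ, φ ((g : G) ^ N) ≤ -N) : 1 / 2 ≤ scl g := by
  have hlim : Tendsto (fun N : ℕ => (1 / 2 : ℝ) - (1 / 2) / N) atTop (𝓝 (1 / 2 - 0)) :=
    tendsto_const_nhds.sub (tendsto_const_div_atTop_nhds_zero_nat _)
  rw [sub_zero] at hlim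
  refine le_of_tendsto_of_tendsto hlim (tendsto_scl g) ?_
  filter_upwards [eventually_gt_atTop 0] with N hN
  have h₁ := hφ.le_of_isProdOfCommutators (isProdOfCommutators_commutatorLength (g ^ N))
  have h₂ := h N
  rw [Subgroup.coe_pow] at h₁
  have h₃ : (N : ℤ) ≤ 2 * commutatorLength (g ^ N) + 1 := by omega
  have h₄ : (N : ℝ) ≤ 2 * commutatorLength (g ^ N) + 1 := by exact_mod_cast h₃
  have hN' : (0 : ℝ) < N := by exact_mod_cast hN
  rw [show (1 / 2 : ℝ) - 1 / 2 / N = (1 / 2 * N - 1 / 2) / N by field_simp]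
  gcongr
  linarith

end IsDefectOne

/-! ### The upper bound for commutators. -/

section UpperBound

variable {G : Type*} [Group G]

theorem isProdOfCommutators_commutatorElement (a b : G) : IsProdOfCommutators ⁅a, b⁆ 1 :=
  ⟨[(a, b)], by simp, by simp⟩

theorem IsProdOfCommutators.conj {g : G} {k : ℕ} (h : IsProdOfCommutators g k) (x : G) :
    IsProdOfCommutators (x * g * x⁻¹) k := by
  obtain ⟨l, rfl, rfl⟩ := h
  refine ⟨l.map fun p => (x * p.1 * x⁻¹, x * p.2 * x⁻¹), by simp, ?_⟩
  induction l with
  | nil => simp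
  | cons p l ih =>
    simp only [List.map_cons, List.prod_cons] at ih ⊢
    rw [ih, ← conjugate_commutatorElement]
    group

/-- Raising the exponent by two costs a single commutator: `d`, a conjugate of one, satisfies `(x *
y)^2 * (x^n * y^n) = d * (x^(n+2) * y^(n+2))`. -/
theorem mul_pow_two_mul (x y : G) (m : ℕ) : ∃ c : G, IsProdOfCommutators c m ∧
    (x * y) ^ (2 * m) = c * (x ^ (2 * m) * y ^ (2 * m)) := by
  induction m with
  | zero => exact ⟨1, ⟨[], rfl, rfl⟩, by simp⟩
  | succ m ih =>
    obtain ⟨c, hc, h⟩ := ih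
    set n := 2 * m
    let w := x * y
    let d := x * ⁅y * w, x ^ n * y⁻¹⁆ * x⁻¹
    have hd : IsProdOfCommutators d 1 := (isProdOfCommutators_commutatorElement _ _).conj x
    refine ⟨(w ^ 2 * c * (w ^ 2)⁻¹) * d, (hc.conj _).mul hd, ?_⟩
    have h₁ : d * (x ^ (n + 2) * y ^ (n + 2)) = w ^ 2 * (x ^ n * y ^ n) := by
      simp only [d, w, commutatorElement_def, pow_add x, pow_add y, pow_two]
      have hx : Commute x (x ^ n) := Commute.self_pow x n
      have hy : Commute y (y ^ n) := Commute.self_pow y n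
      generalize x ^ n = X at *
      generalize y ^ n = Y at *
      have hY : Y * (y * y) = y * y * Y := (hy.mul_left hy).eq.symm
      have hX : X * (x * x) = x * x * X := (hx.mul_left hx).eq.symm
      have hX' : x⁻¹ * X⁻¹ * x⁻¹ * (X * (x * x)) = 1 := by
        rw [hX, show x⁻¹ * X⁻¹ * x⁻¹ * (x * x * X) = x⁻¹ * X⁻¹ * (x * X) by group, hx.eq]
        group
      rw [hY]
      calc _ = x * (y * (x * y) * X * y⁻¹ * y⁻¹) * (x⁻¹ * X⁻¹ * x⁻¹ * (X * (x * x))) *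
            (y * y * Y) := by group
        _ = _ := by rw [hX']; group
    rw [show 2 * (m + 1) = n + 2 by ring, mul_assoc, h₁, add_comm n 2, pow_add, h]
    simp only [w]
    group

theorem scl_commutatorElement_le (c : commutator G) (h : ∃ a b : G, (c : G) = ⁅a, b⁆) :
    scl c ≤ 1 / 2 := by
  obtain ⟨a, b, hab⟩ := h
  have hcl (m : ℕ) : commutatorLength (c ^ (2 * m)) ≤ m + 1 := by
    refine Nat.sInf_le ?_
    -- With these factors, the product of the separate powers is again one commutator, `⁅a, b ^ (2 *
    -- m)⁆`. Even powers suffice because the limit exists.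
    obtain ⟨d, hd, h⟩ := mul_pow_two_mul (a * b * a⁻¹) b⁻¹ m
    have h₁ : ((c ^ (2 * m) : commutator G) : G) = d * ⁅a, b ^ (2 * m)⁆ := by
      rw [Subgroup.coe_pow, hab, commutatorElement_def, h, conj_pow, inv_pow,
        commutatorElement_def]
    show IsProdOfCommutators ((c ^ (2 * m) : commutator G) : G) (m + 1)
    rw [h₁]
    exact hd.mul (isProdOfCommutators_commutatorElement _ _)
  have h₂ : Tendsto (fun m : ℕ => 2 * m) atTop atTop :=
    tendsto_id.const_mul_atTop' (by norm_num)
  have hlim : Tendsto (fun m : ℕ => (1 / 2 : ℝ) + (1 / 2) / m) atTop (𝓝 (1 / 2 + 0)) :=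
    tendsto_const_nhds.add (tendsto_const_div_atTop_nhds_zero_nat _)
  rw [add_zero] at hlim
  refine le_of_tendsto_of_tendsto ((tendsto_scl c).comp h₂) hlim ?_
  filter_upwards [eventually_gt_atTop 0] with m hm
  have hm' : (0 : ℝ) < m := by exact_mod_cast hm
  have h₃ : (commutatorLength (c ^ (2 * m)) : ℝ) ≤ m + 1 := by exact_mod_cast hcl m
  rw [Function.comp_apply, show (1 / 2 : ℝ) + 1 / 2 / m = (m + 1) / (2 * m) by field_simp]
  push_cast
  gcongr

end UpperBound

/-! ### Sharpness and conclusion. -/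

/-- Two non-commuting transpositions of three points serve as images of `v` and `w`; killing all
other vertices respects the relators because `v` and `w` are not adjacent. -/
theorem RAAG.commutatorElement_of_ne_one {V : Type*} {Γ : SimpleGraph V} {v w : V} (hvw : v ≠ w)
    (h : ¬ Γ.Adj v w) : ⁅(RAAG.of v : RAAG Γ), (RAAG.of w : RAAG Γ)⁆ ≠ 1 := by
  classical
  let σ : Equiv.Perm (Fin 3) := Equiv.swap 0 1
  let τ : Equiv.Perm (Fin 3) := Equiv.swap 1 2
  let f : RAAG Γ →* Equiv.Perm (Fin 3) :=
    RAAG.lift (fun u => if u = v then σ else if u = w then τ else 1) fun a b hab => by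
      split_ifs with h₁ h₂ h₃ h₄ h₅ h₆
      · exact Commute.refl _
      · exact absurd (h₁ ▸ h₃ ▸ hab) h
      · exact Commute.one_right _
      · exact absurd (h₄ ▸ h₅ ▸ hab.symm) h
      · exact Commute.refl _
      · exact Commute.one_right _
      all_goals exact Commute.one_left _
  intro heq
  have := congrArg f heq
  rw [map_commutatorElement, map_one] at this
  simp only [f, RAAG.lift_of, if_true, if_neg hvw.symm] at this
  revert this
  decide

theorem theorem7p3 {V : Type*} [Finite V] (Γ : SimpleGraph V) :
    -- the gap: every non-trivial element of the commutator subgroup has `scl ≥ 1/2`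
    (∀ g₀ : commutator (RAAG Γ), g₀ ≠ 1 → (1 / 2 : ℝ) ≤ scl g₀) ∧
    -- commutators have `scl ≤ 1/2`
    (∀ c : commutator (RAAG Γ), (∃ a b : RAAG Γ, (c : RAAG Γ) = ⁅a, b⁆) → scl c ≤ 1 / 2) ∧
    -- sharpness: as soon as `Γ` is not a complete graph, `1/2` is attained by a non-trivial
    -- commutator
    ((∃ v w : V, v ≠ w ∧ ¬ Γ.Adj v w) →
      ∃ c : commutator (RAAG Γ), c ≠ 1 ∧ (∃ a b : RAAG Γ, (c : RAAG Γ) = ⁅a, b⁆) ∧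
        scl c = 1 / 2) := by
  have gap (g₀ : commutator (RAAG Γ)) (h : g₀ ≠ 1) : (1 / 2 : ℝ) ≤ scl g₀ := by
    obtain ⟨φ, hφ, hN⟩ := RAAG.exists_isDefectOne (g₀ : RAAG Γ) (by simpa using h)
    exact hφ.half_le_scl g₀ hN
  refine ⟨gap, scl_commutatorElement_le, ?_⟩
  rintro ⟨v, w, hvw, h⟩
  let c : commutator (RAAG Γ) := ⟨⁅(RAAG.of v : RAAG Γ), (RAAG.of w : RAAG Γ)⁆,
    Subgroup.commutator_mem_commutator (Subgroup.mem_top _) (Subgroup.mem_top _)⟩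
  have hc : c ≠ 1 := fun h' =>
    RAAG.commutatorElement_of_ne_one hvw h (congrArg Subtype.val h')
  have hab : ∃ a b : RAAG Γ, (c : RAAG Γ) = ⁅a, b⁆ := ⟨_, _, rfl⟩
  exact ⟨c, hc, hab, le_antisymm (scl_commutatorElement_le c hab) (gap c hc)⟩
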